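/- Let $n\in\mathbb N$, $1<m<2$ and $q=2-m$, and write $\ln_q t=\frac{t^{1-q}-1}{1-q}$ for $t\ge 0$, $\exp_q t=[1+(1-q)t]_+^{1/(1-q)}$, $U(t)=\int_0^t\exp_q s\,ds$. Let $\mathcal M$ be the family of $q$-Gaussian probability densities on $\mathbb R^n$, $$G_q(x;\theta,\Theta)=\exp_q\bigl(\theta^Tx+x^T\Theta x-\psi(\theta,\Theta)\bigr),$$ with $\theta\in\mathbb R^n$, $\Theta$ a real symmetric negative definite $n\times n$ matrix and $\psi(\theta,\Theta)$ the constant that makes the total mass equal to one. For a probability density $p$ with finite second moments and $g=G_q(\cdot\,;\theta,\Theta)\in\mathcal M$, let $$\mathcal D[p\|g]=\int_{\mathbb R^n}\Bigl(U(\ln_q g(x))-U(\ln_q p(x))-p(x)\bigl[\theta^Tx+x^T\Theta x-\psi(\theta,\Theta)-\ln_q p(x)\bigr]\Bigr)dx .$$ The integrand is nonnegative, and $\mathcal D[p\|g]=+\infty$ if it is not integrable. An m-projection of $p$ to $\mathcal M$ is a $\hat p\in\mathcal M$ with $\mathcal D[p\|\hat p]<\infty$ that minimizes $\mathcal D[p\|g]$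 over $g\in\mathcal M$. For an interval $J\subseteq\mathbb R$ with more than one point, a solution on $J$ of the porous medium equation $\partial u/\partial t=\Delta u^m$ means a nonnegative function $u\in C\bigl(J;L^1(\mathbb R^n)\cap L^m(\mathbb R^n)\bigr)$ that satisfies the equation in the sense of distributions on $\mathrm{int}(J)\times\mathbb R^n$. Its second-moment matrix is $H(t)=\int xx^Tu(x,t)\,dx$. Let $f_0$ be a probability density on $\mathbb R^n$ with finite second moments, and let $\hat f_0\in\mathcal M$ be an m-projection of $f_0$. Let $J_1,J_2$ be intervals as above, both containing $t_0$, and let $u_1$, $u_2$ be solutions of the porous medium equation on $J_1$ and $J_2$, with $u_1(\cdot,t_0)=f_0$ and $u_2(\cdot,t_0)=\hat f_0$ almost everywhere. Then the second moments of $u_i(\cdot,t)$ are finite for all $t\in J_i$, the second-moment matrices $H_1,H_2$ are differentiable at $t_0$ (one-sidedly from within $J_i$ if $t_0$ is an end point of $J_i$), and $$\dot H_1(t_0)-\dot H_2(t_0)=2m(m-1)\,\mathcal D[f_0\|\hat f_0]\,I .$$ -/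

import Mathlib

open MeasureTheory Filter Topology Set
open scoped ContDiff Matrix

noncomputable section

/-- The `q`-logarithm `ln_q t = (t ^ (1 - q) - 1) / (1 - q)`. -/
def lnq (q t : ℝ) : ℝ := (t ^ (1 - q) - 1) / (1 - q)

/-- The `q`-exponential `exp_q t = [1 + (1 - q) t]₊ ^ (1 / (1 - q))`. -/
def expq (q t : ℝ) : ℝ := (max (1 + (1 - q) * t) 0) ^ (1 / (1 - q))

/-- The potential `U t = ∫₀ᵗ exp_q`. -/
def potentialU (q t : ℝ) : ℝ := ∫ s in (0 : ℝ)..t, expq q s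

/-- A `q`-Gaussian probability density on `ℝⁿ`, given by its parameters: a vector `θ`, a real
symmetric negative definite matrix `Θ`, and the normalizing constant `ψ`, that is, the number
for which `exp_q (θᵀ x + xᵀ Θ x - ψ)` has total mass one. These are the points of the
`q`-Gaussian family `𝓜`. -/
structure QGaussian (n : ℕ) (q : ℝ) where
  θ : EuclideanSpace ℝ (Fin n)
  Θ : Matrix (Fin n) (Fin n) ℝ
  ψ : ℝ
  negDef : (-Θ).PosDef
  integrable : Integrable
    (fun x : EuclideanSpace ℝ (Fin n) => expq q (θ ⬝ᵥ x + x ⬝ᵥ (Θ *ᵥ x) - ψ))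
  normalized : ∫ x : EuclideanSpace ℝ (Fin n), expq q (θ ⬝ᵥ x + x ⬝ᵥ (Θ *ᵥ x) - ψ) = 1

namespace QGaussian

variable {n : ℕ} {q : ℝ}

/-- The exponent `θᵀ x + xᵀ Θ x - ψ`. -/
def exponent (g : QGaussian n q) (x : EuclideanSpace ℝ (Fin n)) : ℝ :=
  g.θ ⬝ᵥ x + x ⬝ᵥ (g.Θ *ᵥ x) - g.ψ

/-- The density `G_q(x; θ, Θ)`. -/
def density (g : QGaussian n q) (x : EuclideanSpace ℝ (Fin n)) : ℝ :=
  expq q (g.exponent x)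

end QGaussian

/-- The integrand of the Bregman divergence of `p` from a `q`-Gaussian density `g`:
`U(ln_q g) - U(ln_q p) - p (θᵀ x + xᵀ Θ x - ψ - ln_q p)`. -/
def divergenceIntegrand {n : ℕ} {q : ℝ} (p : EuclideanSpace ℝ (Fin n) → ℝ) (g : QGaussian n q)
    (x : EuclideanSpace ℝ (Fin n)) : ℝ :=
  potentialU q (lnq q (g.density x)) - potentialU q (lnq q (p x))
    - p x * (g.exponent x - lnq q (p x))

/-- The Bregman divergence `𝓓[p ‖ g]`. -/
def divergence {n : ℕ} {q : ℝ} (p : EuclideanSpace ℝ (Fin n) → ℝ) (g : QGaussian n q) : ℝ :=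
  ∫ x, divergenceIntegrand p g x

/-- `g` is an m-projection of `p` to the `q`-Gaussian family: the divergence of `p` from `g`
exists and is minimal among the divergences of `p` from all members of the family. (The integrand
is nonnegative, so a divergence that does not exist is `+∞`, and cannot be smaller.) -/
def IsMProjection {n : ℕ} {q : ℝ} (p : EuclideanSpace ℝ (Fin n) → ℝ) (g : QGaussian n q) : Prop :=
  Integrable (divergenceIntegrand p g) ∧
    ∀ g' : QGaussian n q, Integrable (divergenceIntegrand p g') → divergence p g ≤ divergence p g'

/-- A probability density on `ℝⁿ` with finite second moments. -/
structure IsDensity {n : ℕ} (p : EuclideanSpace ℝ (Fin n) → ℝ) : Prop where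
  nonneg : ∀ᵐ x, 0 ≤ p x
  integrable : Integrable p
  mass : ∫ x, p x = 1
  secondMoment : Integrable (fun x => ‖x‖ ^ 2 * p x)

/-- `u` is a nonnegative weak (distributional) solution of the porous medium equation
`∂u/∂t = Δ(u ^ m)` on `ℝⁿ` over the time interval `J`, in the class `C(J; L¹ ∩ Lᵐ)`.
The function `x ↦ u t x` is the solution at time `t ∈ J`; values outside `J` are irrelevant. If `J`
contains its left end point, continuity there says that the initial datum is attained. -/
structure IsPMESolution {n : ℕ} (m : ℝ) (J : Set ℝ) (u : ℝ → EuclideanSpace ℝ (Fin n) → ℝ) :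
    Prop where
  nonneg : ∀ t ∈ J, ∀ᵐ x, 0 ≤ u t x
  memLp_one : ∀ t ∈ J, MemLp (u t) 1
  memLp_m : ∀ t ∈ J, MemLp (u t) (ENNReal.ofReal m)
  continuous_one : ∀ t ∈ J,
    Tendsto (fun s => eLpNorm (u s - u t) 1 volume) (𝓝[J] t) (𝓝 0)
  continuous_m : ∀ t ∈ J,
    Tendsto (fun s => eLpNorm (u s - u t) (ENNReal.ofReal m) volume) (𝓝[J] t) (𝓝 0)
  weak : ∀ φ : ℝ × EuclideanSpace ℝ (Fin n) → ℝ, ContDiff ℝ ∞ φ → HasCompactSupport φ →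
    tsupport φ ⊆ interior J ×ˢ univ →
    ∫ t, ∫ x, (u t x * deriv (fun s => φ (s, x)) t
      + u t x ^ m * Laplacian.laplacian (fun y => φ (t, y)) x) = 0

/-- The second moment matrix `∫ x xᵀ p(x) dx`. -/
def secondMomentMatrix {n : ℕ} (p : EuclideanSpace ℝ (Fin n) → ℝ) : Matrix (Fin n) (Fin n) ℝ :=
  Matrix.of fun i j => ∫ x : EuclideanSpace ℝ (Fin n), x i * x j * p x

end

/-!
Two facts combine: the second-moment matrix of a solution of the porous medium equation satisfies
`dH/dt = 2 (∫ uᵐ) I`, and the divergence of `p` from an m-projection `g` satisfies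
`m (m - 1) 𝓓[p ‖ g] = ∫ pᵐ - ∫ gᵐ`. Subtracting the first for the two solutions at the common time
and inserting the second gives the theorem.

*Moments* (`IsPMESolution.hasDerivWithinAt_secondMomentMatrix`). Testing the equation with products
`a(t) η(x)` and applying the lemma of du Bois-Reymond on the time axis gives
`∫ u(t) η - ∫ u(s) η = ∫ₛᵗ ∫ uᵐ Δη` for all times `s`, `t` of the interval, end points included. Only
the continuity in time of the two space integrals enters, so no joint measurability of `u` is
needed. For a quadratic polynomial `φ` and a cutoff `χ` one takes
`η(x) = φ(x) χ(x / R) = R² (φ χ)(x / R)`, whose Laplacian is bounded independently of `R` and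
tends to `Δφ`. With `φ = |x|²` this shows that finite second moments persist in both
time directions; with `φ = xᵢ xⱼ` the limit `R → ∞` yields
`H(t) - H(s) = 2 (∫ₛᵗ ∫ uᵐ) I`, and the integrand is continuous in time.

*Divergence* (`IsMProjection.divergence_eq`). Up to terms depending on `p` alone, `𝓓[p ‖ g]` is
`∫ gᵐ / m - ∫ p e`, where `e` is the exponent of `g`. On the support of `g` one has
`gᵐ = g (1 + (m - 1) e)`, so the formula follows from `∫ p e = ∫ g e`. This is the first order
condition for the minimality of `g` along the competitors with exponent `κ e + c`, where `c`
normalizes the mass: convexity of `t ↦ exp_q(t)ᵐ / m`, whose derivative is `exp_q`, gives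
`0 ≤ (κ - 1) ∫ e (exp_q(κ e) - p)` for every `κ > 0`, and `κ → 1` from either side gives the
equality. Differentiability of the normalizing constant in the parameters is never needed.
-/

/-! ### Functions of one variable with a weak derivative -/

theorem exists_Icc_of_isCompact_subset_Ioo {a b : ℝ} (hab : a < b) {S : Set ℝ} (hS : IsCompact S)
    (hSab : S ⊆ Ioo a b) : ∃ a' b', a < a' ∧ b' < b ∧ S ⊆ Icc a' b' := by
  rcases S.eq_empty_or_nonempty with rfl | hne
  · exact ⟨b, a, hab, hab, empty_subset _⟩
  · obtain ⟨a', ha', hla⟩ := hS.exists_isLeast hne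
    obtain ⟨b', hb', hgb⟩ := hS.exists_isGreatest hne
    exact ⟨a', b', (hSab ha').1, (hSab hb').2, fun x hx => ⟨hla hx, hgb hx⟩⟩

/-- A test function on an interval with vanishing integral is the derivative of a test function. -/
theorem exists_test_primitive {a b : ℝ} (hab : a < b) {v : ℝ → ℝ} (hv : ContDiff ℝ ∞ v)
    (hvc : HasCompactSupport v) (hvs : tsupport v ⊆ Ioo a b) (hint : ∫ x, v x = 0) :
    ∃ φ : ℝ → ℝ, ContDiff ℝ ∞ φ ∧ HasCompactSupport φ ∧ tsupport φ ⊆ Ioo a b ∧ deriv φ = v := by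
  obtain ⟨a', b', ha', hb', hsub⟩ := exists_Icc_of_isCompact_subset_Ioo hab hvc hvs
  have hd : ∀ z, HasDerivAt (fun z => ∫ y in a..z, v y) (v z) z := fun z =>
    intervalIntegral.integral_hasDerivAt_right (hv.continuous.intervalIntegrable _ _)
      hv.continuous.stronglyMeasurable.stronglyMeasurableAtFilter hv.continuous.continuousAt
  have hderiv : deriv (fun z => ∫ y in a..z, v y) = v := funext fun z => (hd z).deriv
  have hsupp : tsupport (fun z => ∫ y in a..z, v y) ⊆ Icc a' b' := by
    refine closure_minimal (fun z hz => ?_) isClosed_Icc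
    by_contra hzn
    apply hz
    have hvz : ∀ y, y ∉ Icc a' b' → v y = 0 := fun y hy => by
      by_contra h
      exact hy (hsub (subset_tsupport _ h))
    rcases lt_or_ge z a' with h | h
    · refine intervalIntegral.integral_zero_ae (ae_of_all _ fun y hy => hvz y fun hy' => ?_)
      rcases le_total a z with h1 | h1
      · rw [uIoc_of_le h1] at hy
        linarith [hy.2, hy'.1]
      · rw [uIoc_of_ge h1] at hy
        linarith [hy.2, hy'.1]
    · have h2 : b' < z := by
        by_contra h2
        exact hzn ⟨h, not_lt.1 h2⟩
      show ∫ y in a..z, v y = 0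
      rw [intervalIntegral.integral_eq_integral_of_support_subset, hint]
      intro y hy
      have := hsub (subset_tsupport _ hy)
      exact ⟨ha'.trans_le this.1, this.2.trans h2.le⟩
  refine ⟨fun z => ∫ y in a..z, v y, ?_, ?_, ?_, hderiv⟩
  · rw [contDiff_infty_iff_deriv, hderiv]
    exact ⟨fun z => (hd z).differentiableAt, hv⟩
  · exact isCompact_Icc.of_isClosed_subset (isClosed_tsupport _) hsupp
  · exact fun z hz => ⟨ha'.trans_le (hsupp hz).1, (hsupp hz).2.trans_lt hb'⟩

/-- The lemma of du Bois-Reymond: a continuous function whose distributional derivative vanishes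
on an open interval takes the same value at both end points. -/
theorem eq_of_forall_integral_deriv_mul_eq_zero {a b : ℝ} (hab : a < b) {G : ℝ → ℝ}
    (hG : Continuous G)
    (h : ∀ φ : ℝ → ℝ, ContDiff ℝ ∞ φ → HasCompactSupport φ → tsupport φ ⊆ Ioo a b →
      ∫ t, deriv φ t * G t = 0) : G a = G b := by
  let ψ : ContDiffBump ((a + b) / 2) := ⟨(b - a) / 8, (b - a) / 4, by linarith, by linarith⟩
  have hψs : tsupport (ψ.normed volume) ⊆ Ioo a b := by
    rw [ψ.tsupport_normed_eq, Real.closedBall_eq_Icc]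
    intro x hx
    simp only [ψ, mem_Icc] at hx
    constructor <;> linarith [hx.1, hx.2]
  have hψd : ContDiff ℝ ∞ (ψ.normed volume) := ψ.contDiff_normed
  have hψc : HasCompactSupport (ψ.normed volume) := ψ.hasCompactSupport_normed
  have hψi : ∫ x, ψ.normed volume x = 1 := ψ.integral_normed
  -- Subtracting a multiple of the fixed bump `ψ` from a test function makes its integral vanish,
  -- so that it becomes a derivative; hence `G` equals its average `K` against `ψ`.
  set K := ∫ t, ψ.normed volume t * G t with hK
  have key : ∀ w : ℝ → ℝ, ContDiff ℝ ∞ w → HasCompactSupport w → tsupport w ⊆ Ioo a b →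
      ∫ t, w t • (G t - K) = 0 := by
    intro w hw hwc hws
    have hwi : Integrable w := hw.continuous.integrable_of_hasCompactSupport hwc
    have hψI : Integrable (ψ.normed volume) :=
      hψd.continuous.integrable_of_hasCompactSupport hψc
    have hwG : Integrable (fun t => w t * G t) :=
      (hw.continuous.mul hG).integrable_of_hasCompactSupport hwc.mul_right
    have hψG : Integrable (fun t => ψ.normed volume t * G t) :=
      (hψd.continuous.mul hG).integrable_of_hasCompactSupport hψc.mul_right
    set c := ∫ t, w t
    have hcψ : HasCompactSupport (fun t => c * ψ.normed volume t) := hψc.mul_left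
    obtain ⟨φ, h1, h2, h3, h4⟩ := exists_test_primitive hab
      (v := fun t => w t - c * ψ.normed volume t) (hw.sub (contDiff_const.mul hψd))
      (hwc.sub hcψ)
      ((tsupport_sub _ _).trans (union_subset hws
        ((tsupport_mul_subset_right (f := fun _ => c)).trans hψs)))
      (by rw [integral_sub hwi (hψI.const_mul c), integral_const_mul, hψi]; simp [c])
    have h5 := h φ h1 h2 h3
    rw [h4] at h5
    have h6 : ∫ t, (w t - c * ψ.normed volume t) * G t
        = (∫ t, w t * G t) - c * K := by
      rw [hK, ← integral_const_mul, ← integral_sub hwG (hψG.const_mul c)]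
      congr 1; ext t; ring
    have h7 : ∫ t, w t • (G t - K) = (∫ t, w t * G t) - c * K := by
      rw [← integral_mul_const, ← integral_sub hwG (hwi.mul_const K)]
      congr 1; ext t; simp only [smul_eq_mul]; ring
    rw [h7, ← h6, h5]
  have hae := isOpen_Ioo.ae_eq_zero_of_integral_contDiff_smul_eq_zero (μ := volume)
    (U := Ioo a b) ((hG.sub continuous_const).locallyIntegrable.locallyIntegrableOn _) key
  have hae' : G =ᵐ[volume.restrict (Icc a b)] fun _ => K := by
    rw [← restrict_Ioo_eq_restrict_Icc, EventuallyEq, ae_restrict_iff' measurableSet_Ioo]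
    filter_upwards [hae] with x hx hxm
    exact sub_eq_zero.1 (hx hxm)
  have := Measure.eqOn_Icc_of_ae_eq volume hab.ne hae' hG.continuousOn continuousOn_const
  rw [this (left_mem_Icc.2 hab.le), this (right_mem_Icc.2 hab.le)]

/-- If `A' = B` in the sense of distributions in the interior of an interval and both functions are
continuous up to the end points that belong to it, then the fundamental theorem of calculus holds
between any two points of the interval. -/
theorem sub_eq_integral_of_weak_deriv {J : Set ℝ} (hJ : J.OrdConnected) {A B : ℝ → ℝ}
    (hA : ContinuousOn A J) (hB : ContinuousOn B J)
    (h : ∀ φ : ℝ → ℝ, ContDiff ℝ ∞ φ → HasCompactSupport φ → tsupport φ ⊆ interior J →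
      ∫ t, (A t * deriv φ t + B t * φ t) = 0)
    {s t : ℝ} (hs : s ∈ J) (ht : t ∈ J) : A t - A s = ∫ τ in s..t, B τ := by
  wlog hst : s ≤ t generalizing s t
  · rw [intervalIntegral.integral_symm, ← this ht hs (le_of_not_ge hst)]; ring
  rcases hst.eq_or_lt with rfl | hlt
  · simp
  have hIcc : Icc s t ⊆ J := hJ.out hs ht
  -- Freezing `A` and `B` outside `[s, t]` makes them continuous on the whole line.
  let p : ℝ → ℝ := fun τ => projIcc s t hst τ
  have hp : Continuous p := continuous_subtype_val.comp continuous_projIcc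
  have hpm : ∀ τ, p τ ∈ J := fun τ => hIcc (projIcc s t hst τ).2
  have hpe : ∀ τ ∈ Icc s t, p τ = τ := fun τ hτ => by simp [p, projIcc_of_mem hst hτ]
  have hA' : Continuous (fun τ => A (p τ)) := hA.comp_continuous hp hpm
  have hB' : Continuous (fun τ => B (p τ)) := hB.comp_continuous hp hpm
  let W : ℝ → ℝ := fun z => ∫ τ in s..z, B (p τ)
  have hW : ∀ z, HasDerivAt W (B (p z)) z := fun z =>
    intervalIntegral.integral_hasDerivAt_right (hB'.intervalIntegrable _ _)
      hB'.stronglyMeasurable.stronglyMeasurableAtFilter hB'.continuousAt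
  have hWc : Continuous W := continuous_iff_continuousAt.2 fun z => (hW z).continuousAt
  have := eq_of_forall_integral_deriv_mul_eq_zero hlt (G := fun z => A (p z) - W z)
    (hA'.sub hWc) ?_
  · simp only [hpe s (left_mem_Icc.2 hst), hpe t (right_mem_Icc.2 hst)] at this
    have hWs : W s = 0 := by simp [W]
    have hWt : W t = ∫ τ in s..t, B τ := by
      refine intervalIntegral.integral_congr fun τ hτ => ?_
      rw [uIcc_of_le hst] at hτ
      simp only [hpe τ hτ]
    rw [← hWt]; linarith
  · intro φ hφ hφc hφs
    have hφd : Continuous (deriv φ) := hφ.continuous_deriv (by simp)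
    have h1 := h φ hφ hφc (hφs.trans (interior_maximal (Ioo_subset_Icc_self.trans hIcc) isOpen_Ioo))
    have hi1 : Integrable (fun τ => deriv φ τ * A (p τ)) :=
      (hφd.mul hA').integrable_of_hasCompactSupport hφc.deriv.mul_right
    have hi2 : Integrable (fun τ => deriv φ τ * W τ) :=
      (hφd.mul hWc).integrable_of_hasCompactSupport hφc.deriv.mul_right
    have hi3 : Integrable (fun τ => φ τ * B (p τ)) :=
      (hφ.continuous.mul hB').integrable_of_hasCompactSupport hφc.mul_right
    have hi4 : Integrable (fun τ => φ τ * W τ) :=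
      (hφ.continuous.mul hWc).integrable_of_hasCompactSupport hφc.mul_right
    have hparts := integral_mul_deriv_eq_deriv_mul_of_integrable (u := φ) (v := W)
      (u' := deriv φ) (v' := fun τ => B (p τ))
      (fun x _ => (hφ.differentiable (by simp) x).hasDerivAt) (fun x _ => hW x) hi3 hi2 hi4
    have h2 : ∫ τ, (A τ * deriv φ τ + B τ * φ τ)
        = ∫ τ, (deriv φ τ * A (p τ) + φ τ * B (p τ)) := by
      congr 1; ext τ
      by_cases hτ : τ ∈ tsupport φ
      · rw [hpe τ (Ioo_subset_Icc_self (hφs hτ))]; ring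
      · have e1 : φ τ = 0 := image_eq_zero_of_notMem_tsupport hτ
        have e2 : deriv φ τ = 0 := image_eq_zero_of_notMem_tsupport
          fun hd => hτ (tsupport_deriv_subset hd)
        simp [e1, e2]
    rw [h2, integral_add hi1 hi3, hparts] at h1
    have h3 : ∫ τ, deriv φ τ * (A (p τ) - W τ)
        = (∫ τ, deriv φ τ * A (p τ)) - ∫ τ, deriv φ τ * W τ := by
      rw [← integral_sub hi1 hi2]
      congr 1; ext τ; ring
    rw [h3]; linarith

/-! ### The Laplacian of smooth functions on Euclidean space -/

theorem continuous_laplacian_of_contDiff {n : ℕ} {f : EuclideanSpace ℝ (Fin n) → ℝ}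
    (hf : ContDiff ℝ ∞ f) : Continuous (Laplacian.laplacian f) := by
  rw [InnerProductSpace.laplacian_eq_iteratedFDeriv_orthonormalBasis f
    (EuclideanSpace.basisFun (Fin n) ℝ)]
  have h2 : Continuous (iteratedFDeriv ℝ 2 f) := 
    (contDiff_infty.1 hf 2).continuous_iteratedFDeriv (by simp)
  exact continuous_finsetSum _ fun i _ => h2.eval_const _

theorem hasCompactSupport_laplacian {n : ℕ} {f : EuclideanSpace ℝ (Fin n) → ℝ}
    (hf : HasCompactSupport f) : HasCompactSupport (Laplacian.laplacian f) := by
  rw [InnerProductSpace.laplacian_eq_iteratedFDeriv_orthonormalBasis f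
    (EuclideanSpace.basisFun (Fin n) ℝ)]
  refine (hf.iteratedFDeriv (𝕜 := ℝ) 2).mono fun x hx h0 => hx ?_
  simp [h0]

/-- The parabolic scaling `h ↦ R² h(· / R)` leaves the size of the Laplacian unchanged. -/
theorem laplacian_sq_mul_comp_inv_smul {n : ℕ} {h : EuclideanSpace ℝ (Fin n) → ℝ}
    (hh : ContDiff ℝ ∞ h) {R : ℝ} (hR : R ≠ 0) (x : EuclideanSpace ℝ (Fin n)) :
    Laplacian.laplacian (fun y => R ^ 2 * h (R⁻¹ • y)) x = Laplacian.laplacian h (R⁻¹ • x) := by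
  have h2 : ContDiff ℝ 2 h := contDiff_infty.1 hh 2
  have h2' : ContDiff ℝ 2 (fun y => h (R⁻¹ • y)) := h2.comp (contDiff_const_smul _)
  have e1 : (fun y => R ^ 2 * h (R⁻¹ • y)) = R ^ 2 • fun y => h (R⁻¹ • y) := by
    ext y; simp
  rw [e1, InnerProductSpace.laplacian_smul _ h2'.contDiffAt,
    InnerProductSpace.laplacian_eq_iteratedFDeriv_orthonormalBasis _
      (EuclideanSpace.basisFun (Fin n) ℝ),
    InnerProductSpace.laplacian_eq_iteratedFDeriv_orthonormalBasis h
      (EuclideanSpace.basisFun (Fin n) ℝ)]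
  have := iteratedFDeriv_comp_const_smul (i := 2) (R⁻¹) h2
  simp only [this, smul_eq_mul, Finset.mul_sum]
  refine Finset.sum_congr rfl fun i _ => ?_
  simp only [smul_apply, smul_eq_mul]
  field_simp

theorem laplacian_coord_mul_coord {n : ℕ} (i j : Fin n) (x : EuclideanSpace ℝ (Fin n)) :
    Laplacian.laplacian (fun y : EuclideanSpace ℝ (Fin n) => y i * y j) x
      = 2 * (1 : Matrix (Fin n) (Fin n) ℝ) i j := by
  rw [InnerProductSpace.laplacian_eq_iteratedFDeriv_orthonormalBasis _
    (EuclideanSpace.basisFun (Fin n) ℝ)]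
  let L : Fin n → EuclideanSpace ℝ (Fin n) →L[ℝ] ℝ := fun i => EuclideanSpace.proj i
  have hL : ∀ i (y : EuclideanSpace ℝ (Fin n)), L i y = y i := fun i y => rfl
  have e : (fun y : EuclideanSpace ℝ (Fin n) => y i * y j) = fun y => L i y * L j y := rfl
  have h1 : fderiv ℝ (fun y => L i y * L j y) = fun y => L i y • L j + L j y • L i := by
    ext1 y
    exact ((L i).hasFDerivAt.mul (L j).hasFDerivAt).fderiv
  have h2 : ∀ z, fderiv ℝ (fun y => L i y • L j + L j y • L i) z
      = (L i).smulRight (L j) + (L j).smulRight (L i) := fun z => by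
    exact (((L i).hasFDerivAt.smul_const (L j)).add ((L j).hasFDerivAt.smul_const (L i))).fderiv
  simp only [iteratedFDeriv_two_apply, e, h1, h2]
  simp only [Matrix.cons_val_zero, Matrix.cons_val_one, add_apply,
    ContinuousLinearMap.smulRight_apply, smul_apply, hL, smul_eq_mul,
    EuclideanSpace.basisFun_apply, PiLp.single_apply, Matrix.one_apply]
  simp [Finset.sum_add_distrib]
  rcases eq_or_ne i j with rfl | hij
  · simp; norm_num
  · simp [hij, hij.symm]

/-! ### The porous medium equation tested with functions of space -/

namespace IsPMESolution

variable {n : ℕ} {m : ℝ} {J : Set ℝ} {u : ℝ → EuclideanSpace ℝ (Fin n) → ℝ}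

theorem integrable_rpow (hu : IsPMESolution m J u) (hm : 1 < m) {t : ℝ} (ht : t ∈ J) :
    Integrable (fun x => u t x ^ m) := by
  have h := (hu.memLp_m t ht).integrable_norm_rpow
    (by simp [show 0 < m by linarith]) ENNReal.ofReal_ne_top
  rw [ENNReal.toReal_ofReal (by linarith)] at h
  refine h.congr ?_
  filter_upwards [hu.nonneg t ht] with x hx
  rw [Real.norm_of_nonneg hx]

theorem integrable (hu : IsPMESolution m J u) {t : ℝ} (ht : t ∈ J) : Integrable (u t) :=
  memLp_one_iff_integrable.1 (hu.memLp_one t ht)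

theorem integrable_mul (hu : IsPMESolution m J u) {t : ℝ} (ht : t ∈ J)
    {η : EuclideanSpace ℝ (Fin n) → ℝ} (hη : Continuous η) {C : ℝ} (hC : ∀ x, |η x| ≤ C) :
    Integrable (fun x => u t x * η x) :=
  (hu.integrable ht).mul_bdd (c := C) hη.aestronglyMeasurable (ae_of_all _ hC)

theorem integrable_rpow_mul (hu : IsPMESolution m J u) (hm : 1 < m) {t : ℝ} (ht : t ∈ J)
    {η : EuclideanSpace ℝ (Fin n) → ℝ} (hη : Continuous η) {C : ℝ} (hC : ∀ x, |η x| ≤ C) :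
    Integrable (fun x => u t x ^ m * η x) :=
  (hu.integrable_rpow hm ht).mul_bdd (c := C) hη.aestronglyMeasurable (ae_of_all _ hC)

theorem continuousOn_integral_mul (hu : IsPMESolution m J u)
    {η : EuclideanSpace ℝ (Fin n) → ℝ} (hη : Continuous η) {C : ℝ} (hC : ∀ x, |η x| ≤ C) :
    ContinuousOn (fun t => ∫ x, u t x * η x) J := by
  intro t ht
  have hlim : Tendsto (fun s => (eLpNorm (u s - u t) 1 volume).toReal * C) (𝓝[J] t) (𝓝 0) := by
    have := ((ENNReal.tendsto_toReal ENNReal.zero_ne_top).comp (hu.continuous_one t ht)).mul_const C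
    simpa using this
  refine tendsto_iff_norm_sub_tendsto_zero.2 (squeeze_zero' (Eventually.of_forall fun _ =>
    norm_nonneg _) ?_ hlim)
  filter_upwards [self_mem_nhdsWithin] with s hs
  have hsub : Integrable (u s - u t) := (hu.integrable hs).sub (hu.integrable ht)
  rw [← integral_sub (hu.integrable_mul hs hη hC) (hu.integrable_mul ht hη hC),
    eLpNorm_one_eq_lintegral_enorm, ← integral_norm_eq_lintegral_enorm hsub.1, ← integral_mul_const]
  refine (norm_integral_le_integral_norm _).trans (integral_mono_of_nonneg
    (ae_of_all _ fun _ => norm_nonneg _) (hsub.norm.mul_const C) (ae_of_all _ fun x => ?_))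
  simp only [← sub_mul, norm_mul, Pi.sub_apply]
  exact mul_le_mul_of_nonneg_left (hC x) (norm_nonneg _)

/-- Auxiliary case of `continuousOn_integral_rpow_mul`: for a nonnegative weight `w ^ m` the
integral is the `m`-th power of the `Lᵐ` norm of `u w`, which depends continuously on time. -/
theorem continuousOn_integral_rpow_mul_rpow (hu : IsPMESolution m J u) (hm : 1 < m)
    {w : EuclideanSpace ℝ (Fin n) → ℝ} (hw : Continuous w) (hw0 : ∀ x, 0 ≤ w x)
    {C : ℝ} (hC : ∀ x, |w x| ≤ C) :
    ContinuousOn (fun t => ∫ x, u t x ^ m * w x ^ m) J := by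
  set p := ENNReal.ofReal m with hp
  have hpm : p.toReal = m := ENNReal.toReal_ofReal (by linarith)
  have hp0 : p ≠ 0 := by simp [hp, show 0 < m by linarith]
  have hp1 : 1 ≤ p := by rw [hp]; exact ENNReal.one_le_ofReal.2 hm.le
  have : Fact (1 ≤ p) := ⟨hp1⟩
  have hmem : ∀ t ∈ J, MemLp (fun x => w x * u t x) p := fun t ht =>
    (hu.memLp_m t ht).of_le_mul (c := C)
      (hw.aestronglyMeasurable.mul (hu.memLp_m t ht).aestronglyMeasurable)
      (ae_of_all _ fun x => by
        rw [norm_mul]; exact mul_le_mul_of_nonneg_right (hC x) (norm_nonneg _))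
  have hN : ContinuousOn (fun t => (eLpNorm (fun x => w x * u t x) p volume).toReal) J := by
    intro t ht
    have hlim : Tendsto (fun s => C * (eLpNorm (u s - u t) p volume).toReal) (𝓝[J] t) (𝓝 0) := by
      have := ((ENNReal.tendsto_toReal ENNReal.zero_ne_top).comp
        (hu.continuous_m t ht)).const_mul C
      simpa using this
    refine tendsto_iff_norm_sub_tendsto_zero.2 (squeeze_zero' (Eventually.of_forall fun _ =>
      norm_nonneg _) ?_ hlim)
    filter_upwards [self_mem_nhdsWithin] with s hs
    rw [← Lp.norm_toLp _ (hmem s hs), ← Lp.norm_toLp _ (hmem t ht)]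
    refine (abs_norm_sub_norm_le _ _).trans ?_
    rw [← MemLp.toLp_sub, Lp.norm_toLp]
    have hd : MemLp (u s - u t) p := (hu.memLp_m s hs).sub (hu.memLp_m t ht)
    have hle := eLpNorm_le_mul_eLpNorm_of_ae_le_mul (p := p) (c := C)
      (f := (fun x => w x * u s x) - fun x => w x * u t x) (g := u s - u t) (μ := volume)
      (ae_of_all _ fun x => by
        simp only [Pi.sub_apply, ← mul_sub, norm_mul]
        exact mul_le_mul_of_nonneg_right (hC x) (norm_nonneg _))
    refine (ENNReal.toReal_mono (ENNReal.mul_ne_top ENNReal.ofReal_ne_top hd.2.ne) hle).trans ?_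
    rw [ENNReal.toReal_mul, ENNReal.toReal_ofReal ((abs_nonneg _).trans (hC 0))]
  refine (hN.rpow_const (p := m) fun _ _ => Or.inr (by linarith)).congr fun t ht => ?_
  have h1 := (hmem t ht).eLpNorm_eq_integral_rpow_norm hp0 ENNReal.ofReal_ne_top
  have h2 : ∫ x, ‖w x * u t x‖ ^ m = ∫ x, u t x ^ m * w x ^ m := by
    refine integral_congr_ae ?_
    filter_upwards [hu.nonneg t ht] with x hx
    rw [Real.norm_of_nonneg (mul_nonneg (hw0 x) hx), Real.mul_rpow (hw0 x) hx, mul_comm]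
  have h3 : 0 ≤ ∫ x, ‖w x * u t x‖ ^ m := integral_nonneg fun x => by positivity
  show _ = (eLpNorm (fun x => w x * u t x) p volume).toReal ^ m
  rw [h1, hpm, ENNReal.toReal_ofReal (by positivity), ← Real.rpow_mul h3,
    inv_mul_cancel₀ (by linarith), Real.rpow_one, h2]

theorem continuousOn_integral_rpow (hu : IsPMESolution m J u) (hm : 1 < m) :
    ContinuousOn (fun t => ∫ x, u t x ^ m) J := by
  simpa using hu.continuousOn_integral_rpow_mul_rpow hm (w := fun _ => 1) continuous_const
    (fun _ => zero_le_one) (C := 1) (by simp)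

theorem continuousOn_integral_rpow_mul (hu : IsPMESolution m J u) (hm : 1 < m)
    {ζ : EuclideanSpace ℝ (Fin n) → ℝ} (hζ : Continuous ζ) {C : ℝ} (hC : ∀ x, |ζ x| ≤ C) :
    ContinuousOn (fun t => ∫ x, u t x ^ m * ζ x) J := by
  -- The weight `ζ + C` is nonnegative, hence an `m`-th power, and so is the constant weight.
  have h0 : ∀ x, 0 ≤ ζ x + C := fun x => by linarith [neg_le_of_abs_le (hC x)]
  have h2 : ∀ x, ζ x + C ≤ 2 * C := fun x => by linarith [le_of_abs_le (hC x)]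
  have hw : Continuous fun x => (ζ x + C) ^ m⁻¹ :=
    (hζ.add continuous_const).rpow_const fun _ => Or.inr (by positivity)
  have h := hu.continuousOn_integral_rpow_mul_rpow hm hw (fun x => Real.rpow_nonneg (h0 x) _)
    (C := (2 * C) ^ m⁻¹) fun x => by
      rw [abs_of_nonneg (Real.rpow_nonneg (h0 x) _)]
      exact Real.rpow_le_rpow (h0 x) (h2 x) (by positivity)
  refine (h.sub ((hu.continuousOn_integral_rpow hm).const_smul C)).congr fun t ht => ?_
  have e : ∀ x, ((ζ x + C) ^ m⁻¹) ^ m = ζ x + C := fun x => by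
    rw [← Real.rpow_mul (h0 x), inv_mul_cancel₀ (by linarith), Real.rpow_one]
  simp only [e, mul_add, Pi.sub_apply, Pi.smul_apply, smul_eq_mul]
  rw [integral_add (hu.integrable_rpow_mul hm ht hζ hC) ((hu.integrable_rpow hm ht).mul_const C),
    integral_mul_const]
  ring

/-- The weak formulation tested with a function of the space variable alone, between two arbitrary
times: `∫ u(t) η - ∫ u(s) η = ∫ₛᵗ ∫ uᵐ Δη`. -/
theorem integral_mul_sub_integral_mul (hu : IsPMESolution m J u) (hm : 1 < m)
    (hJ : J.OrdConnected) {η : EuclideanSpace ℝ (Fin n) → ℝ} (hη : ContDiff ℝ ∞ η)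
    (hηc : HasCompactSupport η) {s t : ℝ} (hs : s ∈ J) (ht : t ∈ J) :
    (∫ x, u t x * η x) - ∫ x, u s x * η x
      = ∫ τ in s..t, ∫ x, u τ x ^ m * Laplacian.laplacian η x := by
  obtain ⟨C, hC⟩ := hηc.exists_bound_of_continuous hη.continuous
  have hΔ := continuous_laplacian_of_contDiff hη
  obtain ⟨C', hC'⟩ := (hasCompactSupport_laplacian hηc).exists_bound_of_continuous hΔ
  refine sub_eq_integral_of_weak_deriv hJ (hu.continuousOn_integral_mul hη.continuous hC)
    (hu.continuousOn_integral_rpow_mul hm hΔ hC') ?_ hs ht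
  intro φ hφ hφc hφs
  have hsub : tsupport (fun z : ℝ × EuclideanSpace ℝ (Fin n) => φ z.1 * η z.2)
      ⊆ tsupport φ ×ˢ tsupport η := by
    refine closure_minimal (fun z hz => ?_) ((isClosed_tsupport _).prod (isClosed_tsupport _))
    exact ⟨subset_tsupport _ (left_ne_zero_of_mul hz), subset_tsupport _ (right_ne_zero_of_mul hz)⟩
  have hw := hu.weak (fun z => φ z.1 * η z.2)
    ((hφ.comp contDiff_fst).mul (hη.comp contDiff_snd))
    ((hφc.isCompact.prod hηc.isCompact).of_isClosed_subset (isClosed_tsupport _) hsub)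
    (hsub.trans (prod_mono hφs (subset_univ _)))
  rw [← hw]
  congr 1; ext τ
  have hdφ : ∀ x, deriv (fun s => φ s * η x) τ = deriv φ τ * η x := fun x =>
    deriv_mul_const (hφ.differentiable (by simp) τ) _
  have hΔη : ∀ x, Laplacian.laplacian (fun y => φ τ * η y) x
      = φ τ * Laplacian.laplacian η x := fun x =>
    InnerProductSpace.laplacian_smul (φ τ) (contDiff_infty.1 hη 2).contDiffAt
  simp only [hdφ, hΔη]
  by_cases hτ : τ ∈ tsupport φ
  · have hτJ : τ ∈ J := interior_subset (hφs hτ)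
    rw [← integral_mul_const, ← integral_mul_const, ← integral_add
      ((hu.integrable_mul hτJ hη.continuous hC).mul_const _)
      ((hu.integrable_rpow_mul hm hτJ hΔ hC').mul_const _)]
    congr 1; ext x; ring
  · have e1 : φ τ = 0 := image_eq_zero_of_notMem_tsupport hτ
    have e2 : deriv φ τ = 0 := image_eq_zero_of_notMem_tsupport
      fun hd => hτ (tsupport_deriv_subset hd)
    simp [e1, e2]

end IsPMESolution

/-! ### Evolution of the second moments -/

/-- A smooth cutoff function, equal to one on the closed unit ball. -/
noncomputable def unitCutoff (n : ℕ) : ContDiffBump (0 : EuclideanSpace ℝ (Fin n)) :=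
  ⟨1, 2, one_pos, one_lt_two⟩

namespace IsPMESolution

variable {n : ℕ} {m : ℝ} {J : Set ℝ} {u : ℝ → EuclideanSpace ℝ (Fin n) → ℝ}

/-- The moment identity for a quadratic weight `φ`, cut off at radius `R`. By homogeneity the cut
off weight is `R² h(· / R)` with `h = φ χ` independent of `R`. -/
theorem integral_cutoff_sub (hu : IsPMESolution m J u) (hm : 1 < m) (hJ : J.OrdConnected)
    {φ : EuclideanSpace ℝ (Fin n) → ℝ} (hφ : ContDiff ℝ ∞ φ)
    (hφ2 : ∀ (c : ℝ) x, φ (c • x) = c ^ 2 * φ x) {R : ℝ} (hR : R ≠ 0)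
    {s t : ℝ} (hs : s ∈ J) (ht : t ∈ J) :
    (∫ x, u t x * (φ x * unitCutoff n (R⁻¹ • x))) - ∫ x, u s x * (φ x * unitCutoff n (R⁻¹ • x))
      = ∫ τ in s..t, ∫ x, u τ x ^ m *
          Laplacian.laplacian (fun y => φ y * unitCutoff n y) (R⁻¹ • x) := by
  have hh : ContDiff ℝ ∞ (fun y => φ y * unitCutoff n y) := hφ.mul (unitCutoff n).contDiff
  have hhc : HasCompactSupport (fun y => φ y * unitCutoff n y) :=
    (unitCutoff n).hasCompactSupport.mul_left
  have e : (fun x => φ x * unitCutoff n (R⁻¹ • x))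
      = fun x => R ^ 2 * (φ (R⁻¹ • x) * unitCutoff n (R⁻¹ • x)) := by
    ext x
    rw [hφ2]
    field_simp
  have hη : ContDiff ℝ ∞ (fun x => φ x * unitCutoff n (R⁻¹ • x)) :=
    hφ.mul ((unitCutoff n).contDiff.comp (contDiff_const_smul _))
  have hηc : HasCompactSupport (fun x => φ x * unitCutoff n (R⁻¹ • x)) :=
    ((unitCutoff n).hasCompactSupport.comp_smul (inv_ne_zero hR)).mul_left
  rw [hu.integral_mul_sub_integral_mul hm hJ hη hηc hs ht, e]
  simp only [laplacian_sq_mul_comp_inv_smul hh hR]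

/-- Finite second moments propagate along a solution, forwards and backwards in time. -/
theorem integrable_sq_norm_mul (hu : IsPMESolution m J u) (hm : 1 < m) (hJ : J.OrdConnected)
    {s t : ℝ} (hs : s ∈ J) (ht : t ∈ J) (hint : Integrable (fun x => ‖x‖ ^ 2 * u s x)) :
    Integrable (fun x => ‖x‖ ^ 2 * u t x) := by
  have hφ : ContDiff ℝ ∞ (fun x : EuclideanSpace ℝ (Fin n) => ‖x‖ ^ 2) := contDiff_norm_sq ℝ
  set h := fun y : EuclideanSpace ℝ (Fin n) => ‖y‖ ^ 2 * unitCutoff n y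
  have hh : ContDiff ℝ ∞ h := hφ.mul (unitCutoff n).contDiff
  have hhc : HasCompactSupport h := (unitCutoff n).hasCompactSupport.mul_left
  have hΔ := continuous_laplacian_of_contDiff hh
  obtain ⟨C, hC⟩ := (hasCompactSupport_laplacian hhc).exists_bound_of_continuous hΔ
  have hC0 : 0 ≤ C := (norm_nonneg _).trans (hC 0)
  have hsub : uIcc s t ⊆ J := hJ.uIcc_subset hs ht
  have hMc := (hu.continuousOn_integral_rpow hm).mono hsub
  obtain ⟨D, hD⟩ := isCompact_uIcc.exists_bound_of_continuousOn hMc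
  let I : ℝ := (∫ x, ‖x‖ ^ 2 * u s x) + C * D * |t - s|
  have hcover : AECover (volume : Measure (EuclideanSpace ℝ (Fin n))) atTop
      (fun k : ℕ => Metric.closedBall 0 ((k : ℝ) + 1)) :=
    aecover_closedBall (tendsto_natCast_atTop_atTop.atTop_add tendsto_const_nhds)
  refine hcover.integrable_of_integral_bounded_of_nonneg_ae I (fun k => ?_) ?_
    (Eventually.of_forall fun k => ?_)
  · refine IntegrableOn.continuousOn_mul (hφ.continuous.continuousOn)
      (hu.integrable ht).integrableOn (isCompact_closedBall _ _)
  · filter_upwards [hu.nonneg t ht] with x hx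
    positivity
  · set R : ℝ := (k : ℝ) + 1
    have hR : 0 < R := by positivity
    have hid := hu.integral_cutoff_sub hm hJ hφ
      (fun c x => by rw [norm_smul, mul_pow, Real.norm_eq_abs, sq_abs]) hR.ne' hs ht
    have hηcont : Continuous (fun x : EuclideanSpace ℝ (Fin n) =>
        ‖x‖ ^ 2 * unitCutoff n (R⁻¹ • x)) :=
      hφ.continuous.mul ((unitCutoff n).continuous.comp (continuous_const_smul _))
    have hηc : HasCompactSupport (fun x : EuclideanSpace ℝ (Fin n) =>
        ‖x‖ ^ 2 * unitCutoff n (R⁻¹ • x)) :=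
      ((unitCutoff n).hasCompactSupport.comp_smul (inv_ne_zero hR.ne')).mul_left
    obtain ⟨C₂, hC₂⟩ := hηc.exists_bound_of_continuous hηcont
    have h1 : ∫ x in Metric.closedBall 0 R, ‖x‖ ^ 2 * u t x
        ≤ ∫ x, u t x * (‖x‖ ^ 2 * unitCutoff n (R⁻¹ • x)) := by
      have e1 : ∫ x in Metric.closedBall 0 R, ‖x‖ ^ 2 * u t x
          = ∫ x in Metric.closedBall 0 R, u t x * (‖x‖ ^ 2 * unitCutoff n (R⁻¹ • x)) := by
        refine setIntegral_congr_fun Metric.isClosed_closedBall.measurableSet fun x hx => ?_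
        have : unitCutoff n (R⁻¹ • x) = 1 := by
          refine (unitCutoff n).one_of_mem_closedBall ?_
          rw [mem_closedBall_zero_iff] at hx ⊢
          rw [norm_smul, norm_inv, Real.norm_of_nonneg hR.le]
          show R⁻¹ * ‖x‖ ≤ 1
          rw [inv_mul_le_iff₀ hR]; simpa using hx
        simp only [this]; ring
      rw [e1]
      refine setIntegral_le_integral (hu.integrable_mul ht hηcont hC₂) ?_
      filter_upwards [hu.nonneg t ht] with x hx
      exact mul_nonneg hx (mul_nonneg (by positivity) (unitCutoff n).nonneg)
    have h2 : ∫ x, u s x * (‖x‖ ^ 2 * unitCutoff n (R⁻¹ • x)) ≤ ∫ x, ‖x‖ ^ 2 * u s x := by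
      refine integral_mono_ae (hu.integrable_mul hs hηcont hC₂) hint ?_
      filter_upwards [hu.nonneg s hs] with x hx
      have := mul_le_mul_of_nonneg_left ((unitCutoff n).le_one (x := R⁻¹ • x))
        (mul_nonneg hx (sq_nonneg ‖x‖))
      linarith
    have h3 : ‖∫ τ in s..t, ∫ x, u τ x ^ m * Laplacian.laplacian h (R⁻¹ • x)‖
        ≤ C * D * |t - s| := by
      refine intervalIntegral.norm_integral_le_of_norm_le_const fun τ hτ => ?_
      have hτ' := uIoc_subset_uIcc hτ
      have hτJ := hsub hτ'
      have h4 : ‖∫ x, u τ x ^ m * Laplacian.laplacian h (R⁻¹ • x)‖ ≤ ∫ x, C * u τ x ^ m := by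
        refine norm_integral_le_of_norm_le ((hu.integrable_rpow hm hτJ).const_mul C) ?_
        filter_upwards [hu.nonneg τ hτJ] with x hx
        rw [norm_mul, Real.norm_of_nonneg (Real.rpow_nonneg hx m), mul_comm]
        exact mul_le_mul_of_nonneg_right (hC _) (Real.rpow_nonneg hx m)
      rw [integral_const_mul] at h4
      exact h4.trans (mul_le_mul_of_nonneg_left ((le_abs_self _).trans (hD τ hτ')) hC0)
    have h5 := (le_abs_self _).trans h3
    simp only [I]
    linarith

/-- The moment identity for a quadratic weight `φ`, obtained by removing the cutoff. The Laplacian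
of the cut off weight is uniformly bounded and converges to the constant `Δφ(0)`. -/
theorem integral_mul_sub_of_homogeneous (hu : IsPMESolution m J u) (hm : 1 < m)
    (hJ : J.OrdConnected) {φ : EuclideanSpace ℝ (Fin n) → ℝ} (hφ : ContDiff ℝ ∞ φ)
    (hφ2 : ∀ (c : ℝ) x, φ (c • x) = c ^ 2 * φ x)
    {s t : ℝ} (hs : s ∈ J) (ht : t ∈ J)
    (his : Integrable (fun x => φ x * u s x)) (hit : Integrable (fun x => φ x * u t x)) :
    (∫ x, φ x * u t x) - ∫ x, φ x * u s x
      = Laplacian.laplacian φ 0 * ∫ τ in s..t, ∫ x, u τ x ^ m := by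
  set h := fun y : EuclideanSpace ℝ (Fin n) => φ y * unitCutoff n y with hdef
  have hh : ContDiff ℝ ∞ h := hφ.mul (unitCutoff n).contDiff
  have hhc : HasCompactSupport h := (unitCutoff n).hasCompactSupport.mul_left
  have hΔ := continuous_laplacian_of_contDiff hh
  obtain ⟨C, hC⟩ := (hasCompactSupport_laplacian hhc).exists_bound_of_continuous hΔ
  have hsub : uIcc s t ⊆ J := hJ.uIcc_subset hs ht
  have hΔ0 : Laplacian.laplacian h 0 = Laplacian.laplacian φ 0 := by
    refine (InnerProductSpace.laplacian_congr_nhds ?_).eq_of_nhds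
    filter_upwards [(unitCutoff n).eventuallyEq_one] with y hy
    simp [hdef, hy]
  have hRlim : ∀ x : EuclideanSpace ℝ (Fin n),
      Tendsto (fun k : ℕ => ((k : ℝ) + 1)⁻¹ • x) atTop (𝓝 0) := fun x => by
    have : Tendsto (fun k : ℕ => ((k : ℝ) + 1)⁻¹) atTop (𝓝 0) := by
      simpa using tendsto_one_div_add_atTop_nhds_zero_nat (𝕜 := ℝ)
    simpa using this.smul_const x
  have hmom : ∀ r ∈ J, Integrable (fun x => φ x * u r x) →
      Tendsto (fun k : ℕ => ∫ x, u r x * (φ x * unitCutoff n (((k : ℝ) + 1)⁻¹ • x))) atTop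
        (𝓝 (∫ x, φ x * u r x)) := by
    intro r hr hir
    refine tendsto_integral_of_dominated_convergence (fun x => ‖φ x * u r x‖) (fun k => ?_)
      hir.norm (fun k => ae_of_all _ fun x => ?_) (ae_of_all _ fun x => ?_)
    · exact (hu.integrable hr).1.mul (hφ.continuous.mul ((unitCutoff n).continuous.comp
        (continuous_const_smul _))).aestronglyMeasurable
    · rw [← mul_assoc, mul_comm (u r x), norm_mul]
      refine mul_le_of_le_one_right (norm_nonneg _) ?_
      rw [Real.norm_of_nonneg (unitCutoff n).nonneg]
      exact (unitCutoff n).le_one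
    · have h1 : Tendsto (fun k : ℕ => unitCutoff n (((k : ℝ) + 1)⁻¹ • x)) atTop (𝓝 1) :=
        tendsto_const_nhds.congr' (((hRlim x).eventually
          (unitCutoff n).eventuallyEq_one).mono fun k hk => hk.symm)
      simpa [mul_comm] using (h1.const_mul (φ x)).const_mul (u r x)
  have hlhs := (hmom t ht hit).sub (hmom s hs his)
  have hMc := (hu.continuousOn_integral_rpow hm).mono hsub
  have hcomp : ∀ k : ℕ, Continuous (fun x : EuclideanSpace ℝ (Fin n) =>
      Laplacian.laplacian h (((k : ℝ) + 1)⁻¹ • x)) := fun k =>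
    hΔ.comp (continuous_const_smul _)
  have hbound : ∀ τ ∈ J, ∀ k : ℕ, ∀ᵐ x,
      ‖u τ x ^ m * Laplacian.laplacian h (((k : ℝ) + 1)⁻¹ • x)‖ ≤ C * u τ x ^ m := by
    intro τ hτ k
    filter_upwards [hu.nonneg τ hτ] with x hx
    rw [norm_mul, Real.norm_of_nonneg (Real.rpow_nonneg hx m), mul_comm]
    exact mul_le_mul_of_nonneg_right (hC _) (Real.rpow_nonneg hx m)
  have hrhs : Tendsto (fun k : ℕ => ∫ τ in s..t, ∫ x, u τ x ^ m *
      Laplacian.laplacian h (((k : ℝ) + 1)⁻¹ • x)) atTop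
      (𝓝 (∫ τ in s..t, ∫ x, u τ x ^ m * Laplacian.laplacian φ 0)) := by
    refine intervalIntegral.tendsto_integral_filter_of_dominated_convergence
      (fun τ => C * ∫ x, u τ x ^ m) (Eventually.of_forall fun k => ?_)
      (Eventually.of_forall fun k => ae_of_all _ fun τ hτ => ?_)
      (hMc.intervalIntegrable.const_mul C) (ae_of_all _ fun τ hτ => ?_)
    · refine ContinuousOn.aestronglyMeasurable ?_ measurableSet_uIoc
      exact (hu.continuousOn_integral_rpow_mul hm (hcomp k) fun x => hC _).mono
        (uIoc_subset_uIcc.trans hsub)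
    · have hτJ := hsub (uIoc_subset_uIcc hτ)
      rw [← integral_const_mul]
      exact norm_integral_le_of_norm_le ((hu.integrable_rpow hm hτJ).const_mul C) (hbound τ hτJ k)
    · have hτJ := hsub (uIoc_subset_uIcc hτ)
      refine tendsto_integral_of_dominated_convergence (fun x => C * u τ x ^ m)
        (fun k => (hu.integrable_rpow_mul hm hτJ (hcomp k) fun x => hC _).1)
        ((hu.integrable_rpow hm hτJ).const_mul C) (hbound τ hτJ) (ae_of_all _ fun x => ?_)
      rw [← hΔ0]
      exact ((hΔ.tendsto 0).comp (hRlim x)).const_mul _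
  have heq := tendsto_nhds_unique hlhs (hrhs.congr fun k =>
    (hu.integral_cutoff_sub hm hJ hφ hφ2 (by positivity) hs ht).symm)
  rw [heq]
  simp only [integral_mul_const, intervalIntegral.integral_mul_const]
  ring

theorem integrable_coord_mul_coord_mul (hu : IsPMESolution m J u) (hm : 1 < m)
    (hJ : J.OrdConnected) {s t : ℝ} (hs : s ∈ J) (ht : t ∈ J)
    (hint : Integrable (fun x => ‖x‖ ^ 2 * u s x)) (i j : Fin n) :
    Integrable (fun x : EuclideanSpace ℝ (Fin n) => x i * x j * u t x) := by
  refine (hu.integrable_sq_norm_mul hm hJ hs ht hint).mono ?_ (ae_of_all _ fun x => ?_)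
  · exact (by fun_prop : Continuous fun x : EuclideanSpace ℝ (Fin n) => x i * x j)
      |>.aestronglyMeasurable.mul (hu.integrable ht).1
  · rw [norm_mul, norm_mul, norm_mul, norm_pow, norm_norm, sq]
    gcongr <;> exact PiLp.norm_apply_le x _

/-- The second moment matrix of a solution has the derivative `2 (∫ uᵐ) I`. -/
theorem hasDerivWithinAt_secondMomentMatrix (hu : IsPMESolution m J u) (hm : 1 < m)
    (hJ : J.OrdConnected) {s : ℝ} (hs : s ∈ J)
    (hint : Integrable (fun x => ‖x‖ ^ 2 * u s x)) (i j : Fin n) :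
    HasDerivWithinAt (fun t => secondMomentMatrix (u t) i j)
      ((2 * (∫ x, u s x ^ m)) * (1 : Matrix (Fin n) (Fin n) ℝ) i j) J s := by
  have hφ : ContDiff ℝ ∞ (fun x : EuclideanSpace ℝ (Fin n) => x i * x j) := by fun_prop
  have hMc := hu.continuousOn_integral_rpow hm
  have hFTC : ∀ t ∈ J, secondMomentMatrix (u t) i j - secondMomentMatrix (u s) i j
      = 2 * (1 : Matrix (Fin n) (Fin n) ℝ) i j * ∫ τ in s..t, ∫ x, u τ x ^ m := fun t ht => by
    have := hu.integral_mul_sub_of_homogeneous hm hJ hφ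
      (fun c x => by simp only [PiLp.smul_apply, smul_eq_mul]; ring) hs ht
      (hu.integrable_coord_mul_coord_mul hm hJ hs hs hint i j)
      (hu.integrable_coord_mul_coord_mul hm hJ hs ht hint i j)
    rwa [laplacian_coord_mul_coord] at this
  have hM : HasDerivWithinAt (fun t => ∫ τ in s..t, ∫ x, u τ x ^ m) (∫ x, u s x ^ m) J s := by
    rw [hasDerivWithinAt_iff_isLittleO, Asymptotics.isLittleO_iff]
    intro c hc
    obtain ⟨δ, hδ, hclose⟩ := Metric.continuousWithinAt_iff.1 (hMc s hs) c hc
    filter_upwards [self_mem_nhdsWithin, mem_nhdsWithin_of_mem_nhds (Metric.ball_mem_nhds s hδ)]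
      with t ht htδ
    have hsub : uIcc s t ⊆ J := hJ.uIcc_subset hs ht
    have hi : IntervalIntegrable (fun τ => ∫ x, u τ x ^ m) volume s t :=
      (hMc.mono hsub).intervalIntegrable
    have e : (∫ τ in s..t, ∫ x, u τ x ^ m) - (∫ τ in s..s, ∫ x, u τ x ^ m)
        - (t - s) • ∫ x, u s x ^ m = ∫ τ in s..t, ((∫ x, u τ x ^ m) - ∫ x, u s x ^ m) := by
      rw [intervalIntegral.integral_sub hi intervalIntegrable_const,
        intervalIntegral.integral_same, sub_zero, intervalIntegral.integral_const]
    rw [e]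
    refine intervalIntegral.norm_integral_le_of_norm_le_const fun τ hτ => ?_
    have hτ' := uIoc_subset_uIcc hτ
    refine (hclose (hsub hτ') ?_).le
    rw [Real.dist_eq]
    exact (abs_sub_left_of_mem_uIcc hτ').trans_lt htδ
  have h1 := hM.const_mul (2 * (1 : Matrix (Fin n) (Fin n) ℝ) i j)
  have h2 := (h1.const_add (secondMomentMatrix (u s) i j)).congr_deriv
    (show _ = (2 * (∫ x, u s x ^ m)) * (1 : Matrix (Fin n) (Fin n) ℝ) i j by ring)
  refine h2.congr (fun t ht => ?_) ?_
  · rw [← hFTC t ht]; ring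
  · simp

end IsPMESolution

/-! ### The `q`-exponential and its potential -/

section QExponential

variable {m : ℝ}

theorem expq_two_sub (m t : ℝ) :
    expq (2 - m) t = (max (1 + (m - 1) * t) 0) ^ (1 / (m - 1)) := by
  rw [expq, show 1 - (2 - m) = m - 1 by ring]

theorem expq_nonneg (q t : ℝ) : 0 ≤ expq q t := Real.rpow_nonneg (le_max_right _ _) _

theorem monotone_expq (hm : 1 < m) : Monotone (expq (2 - m)) := by
  intro a b hab
  have hm' : 0 < m - 1 := by linarith
  rw [expq_two_sub, expq_two_sub]
  refine Real.rpow_le_rpow (le_max_right _ _) ?_ (by positivity)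
  gcongr

theorem continuous_expq (hm : 1 < m) : Continuous (expq (2 - m)) := by
  have hm' : 0 < m - 1 := by linarith
  simp only [funext (expq_two_sub m)]
  exact Continuous.rpow_const (by fun_prop) fun _ => Or.inr (by positivity)

theorem expq_eq_zero (hm : 1 < m) {t : ℝ} (ht : t ≤ -(m - 1)⁻¹) : expq (2 - m) t = 0 := by
  have hm' : 0 < m - 1 := by linarith
  have : (m - 1) * t ≤ -1 := by
    calc (m - 1) * t ≤ (m - 1) * -(m - 1)⁻¹ := by gcongr
      _ = -1 := by field_simp
  rw [expq_two_sub, max_eq_right (by linarith), Real.zero_rpow (by positivity)]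

theorem expq_rpow_sub_one (hm : 1 < m) (t : ℝ) :
    expq (2 - m) t ^ (m - 1) = max (1 + (m - 1) * t) 0 := by
  have hm' : 0 < m - 1 := by linarith
  rw [expq_two_sub, ← Real.rpow_mul (le_max_right _ _), one_div_mul_cancel hm'.ne', Real.rpow_one]

/-- Where `exp_q(t) > 0`, its power `m - 1` is `1 + (m - 1) t`; elsewhere both sides vanish. -/
theorem expq_rpow (hm : 1 < m) (t : ℝ) :
    expq (2 - m) t ^ m = expq (2 - m) t * (1 + (m - 1) * t) := by
  have hm' : 0 < m - 1 := by linarith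
  rcases le_total (1 + (m - 1) * t) 0 with h | h
  · have : expq (2 - m) t = 0 := by
      rw [expq_two_sub, max_eq_right h, Real.zero_rpow (by positivity)]
    rw [this, Real.zero_rpow (by linarith), zero_mul]
  · have h1 := expq_rpow_sub_one hm t
    rw [max_eq_left h] at h1
    rw [← h1]
    nth_rewrite 2 [← Real.rpow_one (expq (2 - m) t)]
    rw [← Real.rpow_add' (expq_nonneg _ _) (by linarith)]
    congr 1; ring

/-- Convexity of the potential `t ↦ exp_q(t) ^ m / m`, whose derivative is `exp_q`. It is Young's
inequality with the exponents `m` and `m / (m - 1)`. -/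
theorem expq_rpow_sub_le (hm : 1 < m) (a b : ℝ) :
    (expq (2 - m) b ^ m - expq (2 - m) a ^ m) / m ≤ (b - a) * expq (2 - m) b := by
  have hm' : 0 < m - 1 := by linarith
  have hm0 : 0 < m := by linarith
  set x := expq (2 - m) b with hx
  set y := expq (2 - m) a with hy
  have hx0 : 0 ≤ x := expq_nonneg _ _
  have hy0 : 0 ≤ y := expq_nonneg _ _
  have hconj : m.HolderConjugate (m / (m - 1)) := Real.HolderConjugate.conjExponent hm
  have hY := Real.young_inequality_of_nonneg hx0 (Real.rpow_nonneg hy0 (m - 1)) hconj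
  rw [← Real.rpow_mul hy0, mul_div_cancel₀ _ hm'.ne'] at hY
  have h1 : x * (1 + (m - 1) * a) ≤ x * y ^ (m - 1) := by
    rw [hy, expq_rpow_sub_one hm]
    exact mul_le_mul_of_nonneg_left (le_max_left _ _) hx0
  have h2 : x ^ m = x * (1 + (m - 1) * b) := expq_rpow hm b
  have h3 : y ^ m / (m / (m - 1)) = (m - 1) * (y ^ m / m) := by field_simp
  rw [h3] at hY
  have h4 : x ^ m = m * (x ^ m / m) := by field_simp
  have h5 : (m - 1) * ((x ^ m - y ^ m) / m) ≤ (m - 1) * ((b - a) * x) := by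
    have : (m - 1) * ((x ^ m - y ^ m) / m) = m * (x ^ m / m) - x ^ m / m - (m - 1) * (y ^ m / m) := by
      ring
    rw [this, ← h4]
    nlinarith
  exact le_of_mul_le_mul_left h5 hm'

theorem lnq_two_sub (m s : ℝ) : lnq (2 - m) s = (s ^ (m - 1) - 1) / (m - 1) := by
  rw [lnq, show 1 - (2 - m) = m - 1 by ring]

/-- The argument of `U` stays in the range where `1 + (m - 1) t ≥ 0`, so the truncation in `exp_q`
plays no role. This includes `s = 0`. -/
theorem potentialU_lnq (hm : 1 < m) {s : ℝ} (hs : 0 ≤ s) :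
    potentialU (2 - m) (lnq (2 - m) s) = (s ^ m - 1) / m := by
  have hm' : 0 < m - 1 := by linarith
  have hm0 : 0 < m := by linarith
  set L := lnq (2 - m) s with hL
  have hL1 : 1 + (m - 1) * L = s ^ (m - 1) := by
    rw [hL, lnq_two_sub]; field_simp; ring
  have hcongr : ∫ τ in (0 : ℝ)..L, expq (2 - m) τ
      = ∫ τ in (0 : ℝ)..L, (1 + (m - 1) * τ) ^ (1 / (m - 1)) := by
    refine intervalIntegral.integral_congr fun τ hτ => ?_
    have hτ0 : min 0 L ≤ τ := hτ.1
    have : 0 ≤ 1 + (m - 1) * τ := by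
      have h1 : 0 ≤ 1 + (m - 1) * min 0 L := by
        rcases min_choice 0 L with h | h <;> rw [h]
        · simp
        · rw [hL1]; positivity
      linarith [mul_le_mul_of_nonneg_left hτ0 hm'.le]
    simp only [expq_two_sub, max_eq_left this]
  rw [potentialU, hcongr]
  rw [intervalIntegral.integral_comp_add_mul (fun y => y ^ (1 / (m - 1))) hm'.ne',
    integral_rpow (Or.inl (by have : 0 < 1 / (m - 1) := by positivity
                              linarith)), hL1]
  have e : 1 / (m - 1) + 1 = m / (m - 1) := by field_simp; ring
  rw [e, ← Real.rpow_mul hs, mul_div_cancel₀ _ hm'.ne']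
  simp
  field_simp

end QExponential

/-! ### Growth of the exponent of a `q`-Gaussian -/

section Exponent

variable {n : ℕ}

theorem continuous_dotProduct_mulVec_self (A : Matrix (Fin n) (Fin n) ℝ) :
    Continuous fun x : EuclideanSpace ℝ (Fin n) => x ⬝ᵥ (A *ᵥ x) := by
  simp only [dotProduct, Matrix.mulVec]
  fun_prop

theorem dotProduct_mulVec_self_smul (A : Matrix (Fin n) (Fin n) ℝ) (a : ℝ)
    (x : EuclideanSpace ℝ (Fin n)) :
    (a • x) ⬝ᵥ (A *ᵥ (a • x)) = a ^ 2 * (x ⬝ᵥ (A *ᵥ x)) := by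
  simp only [WithLp.ofLp_smul, Matrix.mulVec_smul, smul_dotProduct, dotProduct_smul, smul_eq_mul]
  ring

theorem Matrix.PosDef.exists_mul_sq_norm_le {A : Matrix (Fin n) (Fin n) ℝ} (hA : A.PosDef) :
    ∃ c > 0, ∀ x : EuclideanSpace ℝ (Fin n), c * ‖x‖ ^ 2 ≤ x ⬝ᵥ (A *ᵥ x) := by
  let Q : EuclideanSpace ℝ (Fin n) → ℝ := fun x => x ⬝ᵥ (A *ᵥ x)
  have hQc : Continuous Q := continuous_dotProduct_mulVec_self _
  have hQpos : ∀ x : EuclideanSpace ℝ (Fin n), x ≠ 0 → 0 < Q x := fun x hx => by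
    have := hA.dotProduct_mulVec_pos (x := x.ofLp) (by simpa using hx)
    simpa [Q] using this
  have hQs : ∀ (a : ℝ) x, Q (a • x) = a ^ 2 * Q x := dotProduct_mulVec_self_smul _
  have hne : ∀ x ∈ Metric.sphere (0 : EuclideanSpace ℝ (Fin n)) 1, x ≠ 0 := fun x hx h0 => by
    simp [h0] at hx
  obtain ⟨C, hC⟩ := (isCompact_sphere (0 : EuclideanSpace ℝ (Fin n)) 1).exists_bound_of_continuousOn
    (f := fun x => (Q x)⁻¹) (hQc.continuousOn.inv₀ fun x hx => (hQpos x (hne x hx)).ne')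
  -- In dimension zero the sphere is empty and `C` carries no sign, hence `|C| + 1`.
  refine ⟨(|C| + 1)⁻¹, by positivity, fun x => ?_⟩
  show _ ≤ Q x
  rcases eq_or_ne x 0 with rfl | hx
  · simp [Q]
  have hx' : 0 < ‖x‖ := norm_pos_iff.2 hx
  have hy : ‖x‖⁻¹ • x ∈ Metric.sphere (0 : EuclideanSpace ℝ (Fin n)) 1 := by
    simp [norm_smul, hx'.ne']
  have h1 := (le_abs_self _).trans (hC _ hy)
  have hQy := hQpos _ (hne _ hy)
  have h2 : (|C| + 1)⁻¹ ≤ Q (‖x‖⁻¹ • x) := by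
    rw [inv_le_comm₀ (by positivity) hQy]
    linarith [le_abs_self C]
  calc (|C| + 1)⁻¹ * ‖x‖ ^ 2 ≤ Q (‖x‖⁻¹ • x) * ‖x‖ ^ 2 := by gcongr
    _ = Q x := by rw [hQs]; field_simp

namespace QGaussian

variable {q : ℝ}

theorem continuous_exponent (g : QGaussian n q) : Continuous g.exponent := by
  unfold QGaussian.exponent
  simp only [dotProduct, Matrix.mulVec]
  fun_prop

theorem abs_linear_le (g : QGaussian n q) (x : EuclideanSpace ℝ (Fin n)) :
    |g.θ ⬝ᵥ x| ≤ ‖g.θ‖ * ‖x‖ := by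
  have := abs_real_inner_le_norm g.θ x
  rwa [EuclideanSpace.inner_eq_star_dotProduct, star_trivial, dotProduct_comm] at this

/-- The exponent tends to `-∞` at infinity, so its superlevel sets are compact. -/
theorem isCompact_superlevel (g : QGaussian n q) (r : ℝ) : IsCompact {x | r ≤ g.exponent x} := by
  obtain ⟨c, hc, hcx⟩ := g.negDef.exists_mul_sq_norm_le
  refine Metric.isCompact_of_isClosed_isBounded
    (isClosed_le continuous_const g.continuous_exponent) ?_
  rw [isBounded_iff_forall_norm_le]
  refine ⟨(‖g.θ‖ + |g.ψ| + |r|) / c + 1, fun x hx => ?_⟩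
  by_contra hlt
  push Not at hlt
  have h1 := hcx x
  rw [Matrix.neg_mulVec, dotProduct_neg] at h1
  have h2 := (le_abs_self _).trans (g.abs_linear_le x)
  have h3 : r ≤ g.θ ⬝ᵥ x + x ⬝ᵥ (g.Θ *ᵥ x) - g.ψ := hx
  have h4 : c * ‖x‖ ^ 2 ≤ ‖g.θ‖ * ‖x‖ + |g.ψ| + |r| := by
    linarith [neg_abs_le g.ψ, neg_abs_le r]
  have h5 : (‖g.θ‖ + |g.ψ| + |r|) / c < ‖x‖ := by linarith
  rw [div_lt_iff₀ hc] at h5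
  have h6 : 1 < ‖x‖ := lt_of_le_of_lt (le_add_of_nonneg_left (by positivity)) hlt
  nlinarith [abs_nonneg g.ψ, abs_nonneg r, norm_nonneg g.θ]

theorem exists_abs_exponent_le (g : QGaussian n q) :
    ∃ C, ∀ x, |g.exponent x| ≤ C * (1 + ‖x‖ ^ 2) := by
  let Q : EuclideanSpace ℝ (Fin n) → ℝ := fun x => x ⬝ᵥ (g.Θ *ᵥ x)
  have hQc : Continuous Q := continuous_dotProduct_mulVec_self _
  have hQs : ∀ (a : ℝ) x, Q (a • x) = a ^ 2 * Q x := dotProduct_mulVec_self_smul _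
  obtain ⟨C, hC⟩ := (isCompact_closedBall (0 : EuclideanSpace ℝ (Fin n)) 1).exists_bound_of_continuousOn
    hQc.continuousOn
  refine ⟨‖g.θ‖ + C + |g.ψ|, fun x => ?_⟩
  have hC0 : 0 ≤ C := (norm_nonneg _).trans (hC 0 (by simp))
  have hQ : |Q x| ≤ C * ‖x‖ ^ 2 := by
    rcases eq_or_ne x 0 with rfl | hx
    · simp [Q]
    have hx' : 0 < ‖x‖ := norm_pos_iff.2 hx
    have h1 := hC (‖x‖⁻¹ • x) (by simp [norm_smul, hx'.ne'])
    rw [hQs, Real.norm_eq_abs, abs_mul, abs_of_nonneg (by positivity)] at h1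
    calc |Q x| = (‖x‖⁻¹ ^ 2 * |Q x|) * ‖x‖ ^ 2 := by field_simp
      _ ≤ C * ‖x‖ ^ 2 := by gcongr
  have h2 := g.abs_linear_le x
  have h3 : |g.exponent x| ≤ |g.θ ⬝ᵥ x| + |Q x| + |g.ψ| :=
    (abs_sub _ _).trans (add_le_add_left (abs_add_le _ _) _)
  have h4 : ‖x‖ ≤ 1 + ‖x‖ ^ 2 := by nlinarith [sq_nonneg (‖x‖ - 1), norm_nonneg x]
  have h5 := mul_le_mul_of_nonneg_left h4 (norm_nonneg g.θ)
  nlinarith [mul_nonneg (abs_nonneg g.ψ) (sq_nonneg ‖x‖), abs_nonneg g.ψ]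

end QGaussian

end Exponent

/-! ### Profiles `exp_q ∘ e` with compact superlevel sets -/

section Profile

variable {n : ℕ} {m : ℝ} {e : EuclideanSpace ℝ (Fin n) → ℝ}

theorem hasCompactSupport_expq_comp (hm : 1 < m) (he : ∀ r, IsCompact {x | r ≤ e x}) :
    HasCompactSupport fun x => expq (2 - m) (e x) :=
  HasCompactSupport.intro (he (-(m - 1)⁻¹)) fun _ hx =>
    expq_eq_zero hm (le_of_lt (not_le.1 hx))

theorem integrable_expq_comp (hm : 1 < m) (hec : Continuous e)
    (he : ∀ r, IsCompact {x | r ≤ e x}) : Integrable fun x => expq (2 - m) (e x) :=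
  ((continuous_expq hm).comp hec).integrable_of_hasCompactSupport
    (hasCompactSupport_expq_comp hm he)

theorem integrable_mul_expq_comp (hm : 1 < m) (hec : Continuous e)
    (he : ∀ r, IsCompact {x | r ≤ e x}) {k : EuclideanSpace ℝ (Fin n) → ℝ} (hk : Continuous k) :
    Integrable fun x => k x * expq (2 - m) (e x) :=
  (hk.mul ((continuous_expq hm).comp hec)).integrable_of_hasCompactSupport
    (hasCompactSupport_expq_comp hm he).mul_left

theorem integrable_expq_comp_rpow (hm : 1 < m) (hec : Continuous e)
    (he : ∀ r, IsCompact {x | r ≤ e x}) : Integrable fun x => expq (2 - m) (e x) ^ m := by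
  simp only [expq_rpow hm, mul_comm (expq (2 - m) _)]
  exact integrable_mul_expq_comp hm hec he (by fun_prop)

theorem isCompact_superlevel_mul_add (he : ∀ r, IsCompact {x | r ≤ e x}) {κ : ℝ} (hκ : 0 < κ)
    (c r : ℝ) : IsCompact {x | r ≤ κ * e x + c} := by
  convert he ((r - c) / κ) using 3 with x
  rw [div_le_iff₀ hκ, mul_comm, sub_le_iff_le_add]

/-- The normalizing constant exists as soon as some shift of the exponent gives mass at least one:
lowering the shift decreases the mass continuously to zero. -/
theorem exists_integral_expq_add_eq_one (hm : 1 < m) (hec : Continuous e)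
    (he : ∀ r, IsCompact {x | r ≤ e x}) {c₀ : ℝ} (hc₀ : 1 ≤ ∫ x, expq (2 - m) (e x + c₀)) :
    ∃ c, ∫ x, expq (2 - m) (e x + c) = 1 := by
  have he' : ∀ c r, IsCompact {x | r ≤ e x + c} := fun c r => by
    simpa using isCompact_superlevel_mul_add he one_pos c r
  obtain ⟨M, hM⟩ := (he 0).exists_bound_of_continuousOn hec.continuousOn
  have hup : ∀ x, e x ≤ max M 0 := fun x => by
    rcases le_total 0 (e x) with h | h
    · exact ((le_abs_self _).trans (hM x h)).trans (le_max_left _ _)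
    · exact h.trans (le_max_right _ _)
  -- Below `c₁` the shifted exponent stays in the range where `exp_q` vanishes.
  set c₁ := min c₀ (-(m - 1)⁻¹ - max M 0)
  have hzero : ∫ x, expq (2 - m) (e x + c₁) = 0 := by
    rw [← integral_zero (EuclideanSpace ℝ (Fin n)) ℝ]
    refine integral_congr_ae (ae_of_all _ fun x => expq_eq_zero hm ?_)
    have : c₁ ≤ -(m - 1)⁻¹ - max M 0 := min_le_right _ _
    linarith [hup x]
  have hcont : ContinuousOn (fun c => ∫ x, expq (2 - m) (e x + c)) (Icc c₁ c₀) := by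
    refine continuousOn_of_dominated (bound := fun x => expq (2 - m) (e x + c₀))
      (fun c _ => (integrable_expq_comp hm (by fun_prop) (he' c)).1)
      (fun c hc => ae_of_all _ fun x => ?_) (integrable_expq_comp hm (by fun_prop) (he' c₀))
      (ae_of_all _ fun x => ?_)
    · rw [Real.norm_of_nonneg (expq_nonneg _ _)]
      exact monotone_expq hm (by linarith [hc.2])
    · exact ((continuous_expq hm).comp (by fun_prop)).continuousOn
  obtain ⟨c, -, hc⟩ := intermediate_value_Icc (min_le_left _ _) hcont
    (show (1 : ℝ) ∈ Icc _ _ from ⟨by simp only [hzero]; exact zero_le_one, hc₀⟩)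
  exact ⟨c, hc⟩

/-- Continuity at `κ = 1` of the profile term in the first variation along the exponents `κ e`. -/
theorem tendsto_integral_mul_expq_mul (hm : 1 < m) (hec : Continuous e)
    (he : ∀ r, IsCompact {x | r ≤ e x}) :
    Tendsto (fun κ : ℝ => ∫ x, e x * expq (2 - m) (κ * e x)) (𝓝 1)
      (𝓝 (∫ x, e x * expq (2 - m) (e x))) := by
  -- For `κ > 1 / 2` the integrand vanishes outside `K`.
  set K := {x | -2 * (m - 1)⁻¹ ≤ e x}
  have hK : IsCompact K := he _
  have hm' : 0 < (m - 1)⁻¹ := by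
    have : 0 < m - 1 := by linarith
    positivity
  obtain ⟨S, hS⟩ := hK.exists_bound_of_continuousOn hec.continuousOn
  have hlim : (fun x => e x * expq (2 - m) (e x)) = fun x => e x * expq (2 - m) (1 * e x) := by
    simp
  rw [hlim]
  refine tendsto_integral_filter_of_dominated_convergence
    (K.indicator fun _ => S * expq (2 - m) (2 * S)) (Eventually.of_forall fun κ => ?_) ?_
    ((integrable_indicator_iff hK.measurableSet).2 (integrableOn_const hK.measure_ne_top))
    (ae_of_all _ fun x => ?_)
  · exact (hec.mul ((continuous_expq hm).comp (by fun_prop))).aestronglyMeasurable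
  · filter_upwards [Ioo_mem_nhds (show (1 / 2 : ℝ) < 1 by norm_num) one_lt_two] with κ hκ
    refine ae_of_all _ fun x => ?_
    by_cases hx : x ∈ K
    · rw [indicator_of_mem hx, norm_mul, Real.norm_of_nonneg (expq_nonneg _ _)]
      have hSx := hS x hx
      have hS0 := (norm_nonneg _).trans hSx
      refine mul_le_mul hSx (monotone_expq hm ?_) (expq_nonneg _ _) hS0
      have h1 : e x ≤ S := (le_abs_self _).trans hSx
      nlinarith [hκ.1, hκ.2]
    · rw [indicator_of_notMem hx, expq_eq_zero hm, mul_zero, norm_zero]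
      have h1 : e x < -2 * (m - 1)⁻¹ := not_le.1 hx
      nlinarith [hκ.1, hκ.2]
  · exact (((continuous_expq hm).comp (by fun_prop : Continuous fun κ : ℝ => κ * e x)).tendsto
      1).const_mul _

end Profile

/-! ### First order condition for the m-projection -/

section Projection

variable {n : ℕ} {m : ℝ}

/-- The `q`-Gaussian family is closed under multiplying the exponent by a positive number, up to
normalization. -/
theorem QGaussian.exists_exponent_eq_mul_add (hm : 1 < m) (g : QGaussian n (2 - m)) {κ : ℝ}
    (hκ : 0 < κ) : ∃ (g' : QGaussian n (2 - m)) (c : ℝ), ∀ x, g'.exponent x = κ * g.exponent x + c := by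
  have hec := g.continuous_exponent
  have he := g.isCompact_superlevel
  have he' : ∀ c r, IsCompact {x | r ≤ κ * g.exponent x + c} :=
    fun c r => isCompact_superlevel_mul_add he hκ c r
  have he0 : ∀ r, IsCompact {x | r ≤ κ * g.exponent x} := fun r => by simpa using he' 0 r
  obtain ⟨S, hS⟩ := (he (-(m - 1)⁻¹)).exists_bound_of_continuousOn hec.continuousOn
  -- On the set where the density can be positive, `|(κ - 1) e| ≤ |κ - 1| S`, so with this shift the
  -- new profile dominates the old one.
  obtain ⟨c, hc⟩ := exists_integral_expq_add_eq_one hm (e := fun x => κ * g.exponent x)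
    (by fun_prop) he0 (c₀ := |κ - 1| * S) (by
      have h1 : ∫ x, expq (2 - m) (g.exponent x) = 1 := g.normalized
      refine h1.symm.trans_le (integral_mono (integrable_expq_comp hm hec he)
        (integrable_expq_comp hm (by fun_prop) (he' _)) fun x => ?_)
      rcases le_total (g.exponent x) (-(m - 1)⁻¹) with hx | hx
      · simp only [expq_eq_zero hm hx]
        exact expq_nonneg _ _
      · refine monotone_expq hm ?_
        have h2 : |(κ - 1) * g.exponent x| ≤ |κ - 1| * S := by
          rw [abs_mul]
          exact mul_le_mul_of_nonneg_left (hS x hx) (abs_nonneg _)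
        linarith [neg_le_of_abs_le h2])
  have hexp : ∀ x : EuclideanSpace ℝ (Fin n), (κ • g.θ) ⬝ᵥ x + x ⬝ᵥ ((κ • g.Θ) *ᵥ x)
      - (κ * g.ψ - c) = κ * g.exponent x + c := fun x => by
    simp only [QGaussian.exponent, WithLp.ofLp_smul, smul_dotProduct, Matrix.smul_mulVec,
      dotProduct_smul, smul_eq_mul]
    ring
  refine ⟨⟨κ • g.θ, κ • g.Θ, κ * g.ψ - c, ?_, ?_, ?_⟩, c, hexp⟩
  · rw [← smul_neg]
    exact g.negDef.smul hκ
  · simp only [hexp]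
    exact integrable_expq_comp hm (by fun_prop) (he' c)
  · simp only [hexp]
    exact hc

/-- The integrand of the divergence, split into a part involving `g` and a part depending on `p`
alone. -/
theorem divergenceIntegrand_eq (hm : 1 < m) {p : EuclideanSpace ℝ (Fin n) → ℝ}
    (g : QGaussian n (2 - m)) {x : EuclideanSpace ℝ (Fin n)} (hp : 0 ≤ p x) :
    divergenceIntegrand p g x = expq (2 - m) (g.exponent x) ^ m / m - g.exponent x * p x
      + ((p x ^ m - p x) / (m - 1) - p x ^ m / m) := by
  have hpow : p x ^ m = p x * p x ^ (m - 1) := by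
    nth_rewrite 2 [← Real.rpow_one (p x)]
    rw [← Real.rpow_add' hp (by linarith)]
    congr 1; ring
  have hm' : m - 1 ≠ 0 := by linarith
  have hm0 : m ≠ 0 := by linarith
  rw [divergenceIntegrand, QGaussian.density, potentialU_lnq hm (expq_nonneg _ _),
    potentialU_lnq hm hp, lnq_two_sub, hpow]
  field_simp
  ring

theorem IsDensity.integrable_exponent_mul {q : ℝ} {p : EuclideanSpace ℝ (Fin n) → ℝ}
    (hp : IsDensity p) (g : QGaussian n q) : Integrable fun x => g.exponent x * p x := by
  obtain ⟨C, hC⟩ := g.exists_abs_exponent_le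
  refine ((hp.integrable.add hp.secondMoment).const_mul C).mono
    (g.continuous_exponent.aestronglyMeasurable.mul hp.integrable.1) ?_
  filter_upwards [hp.nonneg] with x hx
  rw [norm_mul, Real.norm_eq_abs, Real.norm_of_nonneg hx, Pi.add_apply]
  refine le_trans ?_ (le_abs_self _)
  calc |g.exponent x| * p x ≤ C * (1 + ‖x‖ ^ 2) * p x := mul_le_mul_of_nonneg_right (hC x) hx
    _ = C * (p x + ‖x‖ ^ 2 * p x) := by ring

variable {p : EuclideanSpace ℝ (Fin n) → ℝ}

theorem IsDensity.integrable_divergenceIntegrand (hm : 1 < m) (hp : IsDensity p)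
    (hpm : Integrable fun x => p x ^ m) (g : QGaussian n (2 - m)) :
    Integrable (divergenceIntegrand p g) := by
  refine ((((integrable_expq_comp_rpow hm g.continuous_exponent g.isCompact_superlevel).div_const
    m).sub (hp.integrable_exponent_mul g)).add
    (((hpm.sub hp.integrable).div_const (m - 1)).sub (hpm.div_const m))).congr ?_
  filter_upwards [hp.nonneg] with x hx
  rw [divergenceIntegrand_eq hm g hx]
  rfl

theorem IsDensity.divergence_eq (hm : 1 < m) (hp : IsDensity p)
    (hpm : Integrable fun x => p x ^ m) (g : QGaussian n (2 - m)) :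
    divergence p g = (∫ x, expq (2 - m) (g.exponent x) ^ m) / m - (∫ x, g.exponent x * p x)
      + (((∫ x, p x ^ m) - 1) / (m - 1) - (∫ x, p x ^ m) / m) := by
  have i1 := (integrable_expq_comp_rpow hm g.continuous_exponent g.isCompact_superlevel).div_const m
  have i2 := hp.integrable_exponent_mul g
  have i3 := (hpm.sub hp.integrable).div_const (m - 1)
  have i4 := hpm.div_const m
  have h : divergence p g = ∫ x, (expq (2 - m) (g.exponent x) ^ m / m - g.exponent x * p x
      + ((p x ^ m - p x) / (m - 1) - p x ^ m / m)) := by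
    refine integral_congr_ae ?_
    filter_upwards [hp.nonneg] with x hx using divergenceIntegrand_eq hm g hx
  have e1 := integral_add (i1.sub i2) (i3.sub i4)
  have e2 := integral_sub i1 i2
  have e3 := integral_sub i3 i4
  have e4 := integral_sub hpm hp.integrable
  simp only [Pi.sub_apply, integral_div, hp.mass] at e1 e2 e3 e4
  rw [h, e1, e2, e3, e4]

/-- Comparison of an m-projection `g` with the members of the family whose exponent is proportional
to that of `g`. Neither the shift that normalizes the competitor nor its value matters, because the
competitor and `p` have the same mass. -/
theorem IsMProjection.sub_one_mul_nonneg (hm : 1 < m) (hp : IsDensity p)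
    (hpm : Integrable fun x => p x ^ m) {g : QGaussian n (2 - m)} (hg : IsMProjection p g)
    {κ : ℝ} (hκ : 0 < κ) :
    0 ≤ (κ - 1) * ((∫ x, g.exponent x * expq (2 - m) (κ * g.exponent x))
      - ∫ x, g.exponent x * p x) := by
  obtain ⟨g', c, hgc⟩ := g.exists_exponent_eq_mul_add hm hκ
  have hle := hg.2 g' (hp.integrable_divergenceIntegrand hm hpm g')
  rw [hp.divergence_eq hm hpm, hp.divergence_eq hm hpm] at hle
  have hec := g.continuous_exponent
  have he := g.isCompact_superlevel
  have heκ : ∀ r, IsCompact {x | r ≤ κ * g.exponent x} := fun r => by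
    simpa using isCompact_superlevel_mul_add he hκ 0 r
  have i1 := integrable_expq_comp_rpow hm g'.continuous_exponent g'.isCompact_superlevel
  have i2 := integrable_expq_comp_rpow hm hec he
  have i3 := integrable_mul_expq_comp hm (by fun_prop) heκ hec
  have i4 := integrable_expq_comp hm g'.continuous_exponent g'.isCompact_superlevel
  have hmass : ∫ x, expq (2 - m) (g'.exponent x) = 1 := g'.normalized
  have hpe : ∫ x, g'.exponent x * p x = κ * (∫ x, g.exponent x * p x) + c := by
    have : ∀ x, g'.exponent x * p x = κ * (g.exponent x * p x) + c * p x := fun x => by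
      rw [hgc]; ring
    simp only [this]
    rw [integral_add ((hp.integrable_exponent_mul g).const_mul κ) (hp.integrable.const_mul c),
      integral_const_mul, integral_const_mul, hp.mass, mul_one]
  have hconv : (∫ x, expq (2 - m) (g'.exponent x) ^ m) / m
      - (∫ x, expq (2 - m) (g.exponent x) ^ m) / m
      ≤ (κ - 1) * (∫ x, g.exponent x * expq (2 - m) (κ * g.exponent x)) + c := by
    have hR : (κ - 1) * (∫ x, g.exponent x * expq (2 - m) (κ * g.exponent x)) + c
        = ∫ x, ((κ - 1) * (g.exponent x * expq (2 - m) (κ * g.exponent x))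
          + c * expq (2 - m) (g'.exponent x)) := by
      rw [integral_add (i3.const_mul _) (i4.const_mul c), integral_const_mul, integral_const_mul,
        hmass, mul_one]
    rw [hR, ← integral_div, ← integral_div, ← integral_sub (i1.div_const m) (i2.div_const m)]
    refine integral_mono ((i1.div_const m).sub (i2.div_const m))
      ((i3.const_mul _).add (i4.const_mul c)) fun x => ?_
    -- Convexity is used twice: from `e` to `κ e`, and from `κ e` to its normalizing shift.
    have h1 := expq_rpow_sub_le hm (g.exponent x) (κ * g.exponent x)
    have h2 := expq_rpow_sub_le hm (κ * g.exponent x) (g'.exponent x)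
    have h3 : g'.exponent x - κ * g.exponent x = c := by rw [hgc]; ring
    rw [h3] at h2
    rw [sub_div] at h1 h2
    show _ - _ ≤ _
    linarith
  rw [hpe] at hle
  linarith

/-- First order condition for an m-projection in the direction of its own exponent. This single
consequence of moment matching is all that the value of the divergence depends on. -/
theorem IsMProjection.integral_exponent_mul_eq (hm : 1 < m) (hp : IsDensity p)
    (hpm : Integrable fun x => p x ^ m) {g : QGaussian n (2 - m)} (hg : IsMProjection p g) :
    ∫ x, g.exponent x * p x = ∫ x, g.exponent x * expq (2 - m) (g.exponent x) := by
  have hlim := tendsto_integral_mul_expq_mul hm g.continuous_exponent g.isCompact_superlevel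
  refine le_antisymm ?_ ?_
  · refine ge_of_tendsto (hlim.mono_left (nhdsWithin_le_nhds (s := Ioi 1))) ?_
    filter_upwards [self_mem_nhdsWithin] with κ hκ
    have hκ1 : 1 < κ := hκ
    have := hg.sub_one_mul_nonneg hm hp hpm (zero_lt_one.trans hκ1)
    linarith [nonneg_of_mul_nonneg_right this (by linarith)]
  · refine le_of_tendsto (hlim.mono_left (nhdsWithin_le_nhds (s := Iio 1))) ?_
    filter_upwards [self_mem_nhdsWithin, nhdsWithin_le_nhds (Ioi_mem_nhds one_pos)] with κ hκ hκ0
    have hκ1 : κ < 1 := hκ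
    have := hg.sub_one_mul_nonneg hm hp hpm hκ0
    nlinarith

/-- The divergence from an m-projection is the difference of the integrals of the `m`-th powers,
up to the factor `m (m - 1)`. -/
theorem IsMProjection.divergence_eq (hm : 1 < m) (hp : IsDensity p)
    (hpm : Integrable fun x => p x ^ m) {g : QGaussian n (2 - m)} (hg : IsMProjection p g) :
    m * (m - 1) * divergence p g = (∫ x, p x ^ m) - ∫ x, g.density x ^ m := by
  have hm' : m - 1 ≠ 0 := by linarith
  have hm0 : m ≠ 0 := by linarith
  have i1 := integrable_mul_expq_comp hm g.continuous_exponent g.isCompact_superlevel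
    g.continuous_exponent
  have i2 := integrable_expq_comp hm g.continuous_exponent g.isCompact_superlevel
  have hmass : ∫ x, expq (2 - m) (g.exponent x) = 1 := g.normalized
  have hgm : ∫ x, expq (2 - m) (g.exponent x) ^ m
      = 1 + (m - 1) * ∫ x, g.exponent x * expq (2 - m) (g.exponent x) := by
    have : ∀ x, expq (2 - m) (g.exponent x) ^ m = expq (2 - m) (g.exponent x)
        + (m - 1) * (g.exponent x * expq (2 - m) (g.exponent x)) := fun x => by
      rw [expq_rpow hm]; ring
    simp only [this]
    rw [integral_add i2 (i1.const_mul _), integral_const_mul, hmass]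
  simp only [QGaussian.density]
  rw [hp.divergence_eq hm hpm, hg.integral_exponent_mul_eq hm hp hpm]
  set X := ∫ x, g.exponent x * expq (2 - m) (g.exponent x)
  rw [hgm]
  field_simp
  ring

theorem QGaussian.integrable_sq_norm_mul_density (hm : 1 < m) (g : QGaussian n (2 - m)) :
    Integrable fun x => ‖x‖ ^ 2 * g.density x :=
  integrable_mul_expq_comp hm g.continuous_exponent g.isCompact_superlevel (by fun_prop)

end Projection

theorem corollary1 {n : ℕ} {m : ℝ} (hm1 : 1 < m) (hm2 : m < 2)
    (f₀ : EuclideanSpace ℝ (Fin n) → ℝ) (hf₀ : IsDensity f₀)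
    (g : QGaussian n (2 - m)) (hg : IsMProjection f₀ g)
    (J₁ J₂ : Set ℝ) (hJ₁ : J₁.OrdConnected) (hJ₂ : J₂.OrdConnected)
    (hJ₁' : J₁.Nontrivial) (hJ₂' : J₂.Nontrivial)
    (u₁ u₂ : ℝ → EuclideanSpace ℝ (Fin n) → ℝ)
    (hu₁ : IsPMESolution m J₁ u₁) (hu₂ : IsPMESolution m J₂ u₂)
    (t₀ : ℝ) (ht₁ : t₀ ∈ J₁) (ht₂ : t₀ ∈ J₂)
    (h₁ : u₁ t₀ =ᵐ[volume] f₀) (h₂ : u₂ t₀ =ᵐ[volume] g.density) :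
    (∀ t ∈ J₁, ∀ i j, Integrable (fun x : EuclideanSpace ℝ (Fin n) => x i * x j * u₁ t x)) ∧
    (∀ t ∈ J₂, ∀ i j, Integrable (fun x : EuclideanSpace ℝ (Fin n) => x i * x j * u₂ t x)) ∧
    ∃ V₁ V₂ : Matrix (Fin n) (Fin n) ℝ,
      (∀ i j, HasDerivWithinAt (fun t => secondMomentMatrix (u₁ t) i j) (V₁ i j) J₁ t₀) ∧
      (∀ i j, HasDerivWithinAt (fun t => secondMomentMatrix (u₂ t) i j) (V₂ i j) J₂ t₀) ∧
      V₁ - V₂ = (2 * m * (m - 1) * divergence f₀ g) • (1 : Matrix (Fin n) (Fin n) ℝ) := by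
  have hpm : Integrable fun x => f₀ x ^ m :=
    (hu₁.integrable_rpow hm1 ht₁).congr (h₁.mono fun x hx => by simp only [hx])
  have hs₁ : Integrable fun x => ‖x‖ ^ 2 * u₁ t₀ x :=
    hf₀.secondMoment.congr (h₁.mono fun x hx => by simp only [hx])
  have hs₂ : Integrable fun x => ‖x‖ ^ 2 * u₂ t₀ x :=
    (g.integrable_sq_norm_mul_density hm1).congr (h₂.mono fun x hx => by simp only [hx])
  have e₁ : ∫ x, u₁ t₀ x ^ m = ∫ x, f₀ x ^ m :=
    integral_congr_ae (h₁.mono fun x hx => by simp only [hx])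
  have e₂ : ∫ x, u₂ t₀ x ^ m = ∫ x, g.density x ^ m :=
    integral_congr_ae (h₂.mono fun x hx => by simp only [hx])
  refine ⟨fun t ht i j => hu₁.integrable_coord_mul_coord_mul hm1 hJ₁ ht₁ ht hs₁ i j,
    fun t ht i j => hu₂.integrable_coord_mul_coord_mul hm1 hJ₂ ht₂ ht hs₂ i j,
    (2 * ∫ x, u₁ t₀ x ^ m) • 1, (2 * ∫ x, u₂ t₀ x ^ m) • 1,
    fun i j => hu₁.hasDerivWithinAt_secondMomentMatrix hm1 hJ₁ ht₁ hs₁ i j,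
    fun i j => hu₂.hasDerivWithinAt_secondMomentMatrix hm1 hJ₂ ht₂ hs₂ i j, ?_⟩
  have hD := hg.divergence_eq hm1 hf₀ hpm
  rw [← sub_smul, e₁, e₂]
  congr 1
  linarith
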